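/- Let $t\ge 2$ be an integer, $\alpha=\big(2-t+\sqrt{t^2+4}\,\big)/2$, $A(n)=\lfloor n\alpha\rfloor$ for $n\ge 1$, and let $\Delta AA$ be the infinite word with letters $\Delta AA(n)=A(A(n+1))-A(A(n))$, $n=1,2,\dots$. Then $\Delta AA$ is a morphic word, i.e., the image under a letter-to-letter map of an infinite word $\varphi^{\omega}(a)=\lim_n\varphi^n(a)$, where $\varphi$ is a morphism on a finite alphabet that is prolongable on the letter $a$ (that is, $\varphi(a)=au$ with $\varphi^n(u)$ non-empty for all $n\ge 0$). More precisely, let $\tau$ and $\delta$ be the following morphisms, both from words over the alphabet $\{1,2,\dots,t+1\}$ to words over the same alphabet. (We write $[k]$ for the letter $k$; an increasing run $[a]\,[a+1]\dots[b]$ with $b<a$ is empty; $1^m$ is the word of $m$ letters $1$.) For $t=2$: $\tau(1)=12,\ \tau(2)=131,\ \tau(3)=121$ and $\delta(1)=13,\ \delta(2)=222,\ \delta(3)=132$. For $t=3$: $\tau(1)=123,\ \tau(2)=124,\ \tau(3)=1141,\ \tau(4)=1241$ and $\delta(1)=113,\ \delta(2)=122,\ \delta(3)=2122,\ \delta(4)=1222$.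 For $t\ge 4$: $$\tau(1)=[1]\dots[t],\qquad \tau(2)=[1]\dots[t-1]\,[t+1],$$ $$\tau(j)=[1]\dots[t-j]\;[t-j+1]\,[t-j+1]\;[t-j+2]\dots[t-2]\;[t+1]\quad (3\le j\le t-1),$$ $$\tau(t)=[1]\;[1]\,[2]\dots[t-2]\;[t+1]\,[1],\qquad \tau(t+1)=[1]\,[2]\;[2]\,[3]\dots[t-2]\;[t+1]\,[1],$$ and $$\delta(1)=1^{t-1}\,3,\qquad \delta(2)=1^{t-2}\,22,\qquad \delta(j)=1^{t-j}\,2\,1^{j-2}\,2\quad(3\le j\le t-1),$$ $$\delta(t)=2\,1^{t-2}\,22,\qquad \delta(t+1)=12\,1^{t-3}\,22.$$ Then $\tau$ has exactly one fixed point among the infinite words over $\{1,\dots,t+1\}$, and $\Delta AA$ is the decoration of this fixed point $x=x_1x_2x_3\dots$ by $\delta$, i.e., $\Delta AA=\delta(x_1)\delta(x_2)\delta(x_3)\cdots$. -/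

import Mathlib

/-! Infinite words over an alphabet `α` are sequences `ℕ → α`; position `0` is the first letter.
A morphism of words `α* → β*` is given by its values `φ : α → List β` on letters; its value on a
finite word `u` is `u.flatMap φ`. -/

namespace MetallicBeatty

/-- The prefix of length `n` of an infinite word. -/
def wordPrefix {α : Type*} (x : ℕ → α) (n : ℕ) : List α := (List.range n).map x

/-- The finite word `u` is a prefix of the infinite word `x`. -/
def IsPrefixOf {α : Type*} (u : List α) (x : ℕ → α) : Prop := u = wordPrefix x u.length

/-- The infinite word `y` is the image `φ(x) = φ(x₀)φ(x₁)φ(x₂)⋯` of the infinite word `x` under the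
morphism `φ`: the words `φ(x₀⋯xₙ₋₁)` are prefixes of `y`, of unbounded length.
In this case `y` is also called the decoration of `x` by `φ`. -/
def IsImage {α β : Type*} (φ : α → List β) (x : ℕ → α) (y : ℕ → β) : Prop :=
  (∀ n, IsPrefixOf ((wordPrefix x n).flatMap φ) y) ∧
    ∀ m, ∃ n, m ≤ ((wordPrefix x n).flatMap φ).length

/-- `x` is an infinite word with all its letters in `S`, and it is a fixed point of `φ`. -/
def IsFixedPointOn {α : Type*} (S : Set α) (φ : α → List α) (x : ℕ → α) : Prop :=
  (∀ n, x n ∈ S) ∧ IsImage φ x x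

/-- The morphism `φ` maps every letter of `S` to a word over `S`. -/
def MapsLetters {α : Type*} (S : Set α) (φ : α → List α) : Prop :=
  ∀ a ∈ S, ∀ b ∈ φ a, b ∈ S

/-- The iterate `φⁿ(u)` of a morphism on a finite word. -/
def iter {α : Type*} (φ : α → List α) (n : ℕ) (u : List α) : List α :=
  (fun v : List α => v.flatMap φ)^[n] u

/-- `φ` is prolongable on `a`: `φ(a) = a u` with `φⁿ(u)` non-empty for all `n`. Then the words
`φⁿ(a)` converge to an infinite fixed point `φ^ω(a)` of `φ`. -/
def Prolongable {α : Type*} (φ : α → List α) (a : α) : Prop :=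
  ∃ u : List α, φ a = a :: u ∧ ∀ n, iter φ n u ≠ []

/-- An infinite word `w` is morphic if it is the image under a letter-to-letter map `c` of the
infinite word `x = φ^ω(a)`, where `φ` is a morphism on a finite alphabet, prolongable on `a`. -/
def IsMorphic {β : Type*} (w : ℕ → β) : Prop :=
  ∃ (k : ℕ) (φ : Fin k → List (Fin k)) (a : Fin k) (c : Fin k → β) (x : ℕ → Fin k),
    Prolongable φ a ∧ (∀ n, IsPrefixOf (iter φ n [a]) x) ∧ ∀ n, w n = c (x n)

/-- The number `α = (2 - t + √(t² + 4)) / 2`. -/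
noncomputable def metallicMean (t : ℕ) : ℝ := (2 - (t : ℝ) + Real.sqrt ((t : ℝ) ^ 2 + 4)) / 2

/-- The Beatty sequence `A(n) = ⌊nα⌋`. -/
noncomputable def beatty (α : ℝ) (n : ℤ) : ℤ := ⌊(n : ℝ) * α⌋

/-- The first differences `ΔS(n) = S(n+1) - S(n)`. -/
def firstDiff (S : ℤ → ℤ) (n : ℤ) : ℤ := S (n + 1) - S n

/-- The infinite word `ΔAA = ΔAA(1) ΔAA(2) ΔAA(3) ⋯`, where `A` is the Beatty sequence of `α`. -/
noncomputable def deltaAA (α : ℝ) (n : ℕ) : ℤ :=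
  firstDiff (fun m => beatty α (beatty α m)) ((n : ℤ) + 1)

/-- The alphabet `{1, …, t+1}`. -/
def alphabet (t : ℕ) : Set ℕ := Set.Icc 1 (t + 1)

/-- The word `a [a+1] ⋯ b`, which is empty if `b < a`. -/
def seg (a b : ℕ) : List ℕ := List.range' a (b + 1 - a)

/-- The power `1^m`. -/
def ones (m : ℕ) : List ℕ := List.replicate m 1

/-- The morphism `τ` on `{1, …, t+1}`, for `t ≥ 4`. (Outside of the alphabet, it takes the
irrelevant value `[]`.) -/
def tauGen (t j : ℕ) : List ℕ :=
  if j = 1 then seg 1 t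
  else if j = 2 then seg 1 (t - 1) ++ [t + 1]
  else if 3 ≤ j ∧ j ≤ t - 1 then
    seg 1 (t - j) ++ [t - j + 1, t - j + 1] ++ seg (t - j + 2) (t - 2) ++ [t + 1]
  else if j = t then [1] ++ seg 1 (t - 2) ++ [t + 1, 1]
  else if j = t + 1 then [1, 2] ++ seg 2 (t - 2) ++ [t + 1, 1]
  else []

/-- The morphism `δ` on `{1, …, t+1}`, for `t ≥ 4`. -/
def deltaGen (t j : ℕ) : List ℕ :=
  if j = 1 then ones (t - 1) ++ [3]
  else if j = 2 then ones (t - 2) ++ [2, 2]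
  else if 3 ≤ j ∧ j ≤ t - 1 then ones (t - j) ++ [2] ++ ones (j - 2) ++ [2]
  else if j = t then [2] ++ ones (t - 2) ++ [2, 2]
  else if j = t + 1 then [1, 2] ++ ones (t - 3) ++ [2, 2]
  else []

/-- The morphism `τ` on the alphabet `{1, …, t+1}`, for `t ≥ 2`. -/
def tau (t : ℕ) : ℕ → List ℕ :=
  match t with
  | 2 => fun
    | 1 => [1, 2]
    | 2 => [1, 3, 1]
    | 3 => [1, 2, 1]
    | _ => []
  | 3 => fun
    | 1 => [1, 2, 3]
    | 2 => [1, 2, 4]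
    | 3 => [1, 1, 4, 1]
    | 4 => [1, 2, 4, 1]
    | _ => []
  | t => tauGen t

/-- The morphism `δ` on the alphabet `{1, …, t+1}`, for `t ≥ 2`. -/
def delta (t : ℕ) : ℕ → List ℕ :=
  match t with
  | 2 => fun
    | 1 => [1, 3]
    | 2 => [2, 2, 2]
    | 3 => [1, 3, 2]
    | _ => []
  | 3 => fun
    | 1 => [1, 1, 3]
    | 2 => [1, 2, 2]
    | 3 => [2, 1, 2, 2]
    | 4 => [1, 2, 2, 2]
    | _ => []
  | t => deltaGen t

end MetallicBeatty

namespace MetallicBeatty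

/-! Put θ = α - 1, so that θ(θ + t) = 1, and follow the rotation orbit {(n+1)θ}. Up to an integer
combination of n+1 and ⌊(n+1)θ⌋, the value A(A(n+1)) is `-param` (`beatty_beatty`). Hence a letter
of ΔAA depends only on `param` at its position and the next one, and on whether the orbit wraps
around there (`IsLong`). The pairs (`param`, `IsLong`) that can occur are coded by the t+1 letters
of `fixedWord`.

The rotation is self-similar because 1/θ = t + θ: successive wraps are t or t+1 steps apart. Cut the
orbit into blocks with the wrap at index t-1. Along block n the orbit is an affine function of
`orbit θ n` (`orbit_blockStart_add`), and the block has length t+1 exactly when n is itself a wrap.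
So letter n determines the letters of `fixedWord` and of ΔAA over block n
(`fixedWord_blockStart_add`, `deltaAA_blockStart_add`), and these are the words τ and δ assign to
it. Morphicity follows by pairing the two words letter by letter. -/

/-! ### Prefixes, block decompositions and morphic words -/

theorem length_wordPrefix {α : Type*} (x : ℕ → α) (n : ℕ) : (wordPrefix x n).length = n := by
  simp [wordPrefix]

theorem wordPrefix_succ {α : Type*} (x : ℕ → α) (n : ℕ) :
    wordPrefix x (n + 1) = wordPrefix x n ++ [x n] := by
  simp [wordPrefix, List.range_succ]

theorem wordPrefix_add {α : Type*} (x : ℕ → α) (n m : ℕ) :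
    wordPrefix x (n + m) = wordPrefix x n ++ wordPrefix (fun i => x (n + i)) m := by
  simp [wordPrefix, List.range_add, Function.comp_def]

theorem isPrefixOf_wordPrefix {α : Type*} (x : ℕ → α) (n : ℕ) : IsPrefixOf (wordPrefix x n) x := by
  rw [IsPrefixOf, length_wordPrefix]

/-- If the word `φ(xₙ)` occurs in `y` at position `P n`, and these occurrences are adjacent, then
`φ(x₀⋯xₙ₋₁)` is the prefix of `y` of length `P n`. -/
theorem flatMap_wordPrefix {α β : Type*} {φ : α → List β} {x : ℕ → α} {y : ℕ → β} {P L : ℕ → ℕ}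
    (hP0 : P 0 = 0) (hP : ∀ n, P (n + 1) = P n + L n)
    (hφ : ∀ n, φ (x n) = wordPrefix (fun i => y (P n + i)) (L n)) (n : ℕ) :
    (wordPrefix x n).flatMap φ = wordPrefix y (P n) := by
  induction n with
  | zero => simp [wordPrefix, hP0]
  | succ n ih => simp [wordPrefix_succ, ih, hφ, hP, wordPrefix_add]

theorem isImage_of_blocks {α β : Type*} {φ : α → List β} {x : ℕ → α} {y : ℕ → β} {P L : ℕ → ℕ}
    (hP0 : P 0 = 0) (hP : ∀ n, P (n + 1) = P n + L n) (hL : ∀ n, 1 ≤ L n)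
    (hφ : ∀ n, φ (x n) = wordPrefix (fun i => y (P n + i)) (L n)) : IsImage φ x y := by
  refine ⟨fun n => ?_, fun m => ⟨m, ?_⟩⟩
  · rw [flatMap_wordPrefix hP0 hP hφ]
    exact isPrefixOf_wordPrefix y _
  · rw [flatMap_wordPrefix hP0 hP hφ, length_wordPrefix]
    exact (strictMono_nat_of_lt_succ fun n => by have := hP n; have := hL n; omega).le_apply

theorem iter_succ {α : Type*} (φ : α → List α) (n : ℕ) (u : List α) :
    iter φ (n + 1) u = (iter φ n u).flatMap φ :=
  Function.iterate_succ_apply' _ _ _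

theorem iter_ne_nil {α : Type*} {φ : α → List α} (hφ : ∀ a, φ a ≠ []) {u : List α} (hu : u ≠ [])
    (n : ℕ) : iter φ n u ≠ [] := by
  induction n with
  | zero => exact hu
  | succ n ih =>
    rw [iter_succ]
    obtain ⟨a, ha⟩ := List.exists_mem_of_ne_nil _ ih
    intro h
    exact hφ a (List.flatMap_eq_nil_iff.1 h a ha)

/-- A coding of a fixed point with finitely many letters of a non-erasing morphism is morphic. -/
theorem isMorphic_of_blocks {α β : Type*} {φ : α → List α} {Y : ℕ → α} {P L : ℕ → ℕ}
    (hY : (Set.range Y).Finite) (hP0 : P 0 = 0) (hP : ∀ n, P (n + 1) = P n + L n)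
    (hL : ∀ n, 1 ≤ L n) (hL0 : 2 ≤ L 0)
    (hφ : ∀ n, φ (Y n) = wordPrefix (fun i => Y (P n + i)) (L n)) (c : α → β) :
    IsMorphic (fun n => c (Y n)) := by
  classical
  have := hY.fintype
  let e := Fintype.equivFin (Set.range Y)
  let x : ℕ → Fin (Fintype.card (Set.range Y)) := fun n => e ⟨Y n, n, rfl⟩
  -- The value `x 0` off the range is arbitrary: every letter met in the images of letters of `Y`
  -- lies in the range.
  let r : α → Fin (Fintype.card (Set.range Y)) := fun a =>
    if h : a ∈ Set.range Y then e ⟨a, h⟩ else x 0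
  have hr : ∀ n, r (Y n) = x n := fun n => by simp [r, x]
  let ψ : Fin (Fintype.card (Set.range Y)) → List (Fin (Fintype.card (Set.range Y))) :=
    fun k => (φ (e.symm k)).map r
  have hψ : ∀ n, ψ (x n) = wordPrefix (fun i => x (P n + i)) (L n) := fun n => by
    simp [ψ, x, hφ, wordPrefix, Function.comp_def, hr]
  have hne : ∀ k, ψ k ≠ [] := fun k => by
    obtain ⟨⟨_, n, rfl⟩, rfl⟩ := e.surjective k
    have h := hψ n
    change ψ (x n) ≠ []
    rw [h, ← List.length_pos_iff, length_wordPrefix]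
    exact hL n
  refine ⟨_, ψ, x 0, fun k => c (e.symm k), x, ?_, fun n => ?_, fun n => by simp [x]⟩
  · obtain ⟨l, hl⟩ := Nat.exists_eq_add_of_le hL0
    refine ⟨wordPrefix (fun i => x (1 + i)) (l + 1), ?_, iter_ne_nil hne ?_⟩
    · rw [hψ 0, hl, show 2 + l = 1 + (l + 1) by omega, wordPrefix_add, hP0]
      simp [wordPrefix]
    · rw [← List.length_pos_iff, length_wordPrefix]
      omega
  · suffices h : ∃ q, iter ψ n [x 0] = wordPrefix x q by
      obtain ⟨q, hq⟩ := h
      rw [hq]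
      exact isPrefixOf_wordPrefix x q
    induction n with
    | zero => exact ⟨1, rfl⟩
    | succ n ih =>
      obtain ⟨q, hq⟩ := ih
      exact ⟨P q, by rw [iter_succ, hq, flatMap_wordPrefix hP0 hP hψ]⟩

/-! ### Uniqueness of fixed points -/

theorem two_mul_le_length_flatMap {α : Type*} {φ : α → List α} (u : List α)
    (hφ : ∀ a ∈ u, 2 ≤ (φ a).length) : 2 * u.length ≤ (u.flatMap φ).length := by
  induction u with
  | nil => simp
  | cons a u ih =>
    have h1 := hφ a (by simp)
    have h2 := ih fun b hb => hφ b (by simp [hb])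
    simp only [List.flatMap_cons, List.length_append, List.length_cons]
    omega

theorem IsPrefixOf.take {α : Type*} {u : List α} {x : ℕ → α} (h : IsPrefixOf u x) {n : ℕ}
    (hn : n ≤ u.length) : u.take n = wordPrefix x n := by
  rw [h, wordPrefix, wordPrefix, ← List.map_take, List.take_range, min_eq_left hn]

/-- A morphism has at most one fixed point over `S` if the images of the letters of `S` have length
at least two and begin with the same letter. -/
theorem isFixedPointOn_unique {α : Type*} {S : Set α} {φ : α → List α} (a : α)
    (hφ : ∀ b ∈ S, ∃ c u, φ b = a :: c :: u) {x y : ℕ → α} (hx : IsFixedPointOn S φ x)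
    (hy : IsFixedPointOn S φ y) : y = x := by
  have hlen : ∀ z, IsFixedPointOn S φ z → ∀ n,
      2 * n ≤ ((wordPrefix z n).flatMap φ).length := fun z hz n => by
    have h := two_mul_le_length_flatMap (φ := φ) (wordPrefix z n) fun b hb => by
      obtain ⟨i, -, rfl⟩ := List.mem_map.1 hb
      obtain ⟨c, u, hu⟩ := hφ _ (hz.1 i)
      simp [hu]
    rwa [length_wordPrefix] at h
  have hzero : ∀ z, IsFixedPointOn S φ z → z 0 = a := fun z hz => by
    have h := (hz.2.1 1).take (n := 1) (by have := hlen z hz 1; omega)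
    obtain ⟨c, u, hu⟩ := hφ _ (hz.1 0)
    simp [wordPrefix, hu] at h
    exact h.symm
  -- The image of a prefix of length n+1 has length at least 2(n+1) ≥ n+2, so each prefix forces one
  -- more letter.
  have key : ∀ n, wordPrefix y (n + 1) = wordPrefix x (n + 1) := fun n => by
    induction n with
    | zero => simp [wordPrefix, hzero x hx, hzero y hy]
    | succ n ih =>
      rw [← (hx.2.1 (n + 1)).take (by have := hlen x hx (n + 1); omega),
        ← (hy.2.1 (n + 1)).take (by have := hlen y hy (n + 1); omega), ih]
  funext n
  have h := key n
  simp only [wordPrefix_succ] at h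
  simpa using (List.append_inj' h rfl).2

/-! ### Positionwise formulas for τ and δ -/

/-- The parameter `m` of the letter `j`: see `tauLetter` and `deltaLetter`. -/
def letterParam (t j : ℕ) : ℕ := if j = t + 1 then t - 1 else j

/-- The common length of `τ(j)` and `δ(j)`. -/
def blockLength (t j : ℕ) : ℕ := if t ≤ j then t + 1 else t

/-- The letter at position `i` of `τ(j)`, where `m` is the parameter of `j`. -/
def tauLetter (t m i : ℕ) : ℕ :=
  if i + 1 < t then (if i + m ≤ t then i + 1 else i)
  else if i < t then (if m = 1 then t else t + 1) else 1

/-- The letter at position `i` of `δ(j)`, where `m` is the parameter of `j`. -/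
def deltaLetter (t m i : ℕ) : ℕ :=
  if i + 1 < t then (if i + m = t then 2 else 1)
  else if i < t then (if m = 1 then 3 else 2) else 2

theorem tauGen_eq {t j : ℕ} (ht : 4 ≤ t) (h1 : 1 ≤ j) (h2 : j ≤ t + 1) :
    tauGen t j = (List.range (blockLength t j)).map (tauLetter t (letterParam t j)) := by
  unfold tauGen
  split_ifs with c1 c2 c3 c4 c5
  all_goals
    try omega
  all_goals
    apply List.ext_getElem
    · simp [seg, blockLength]; grind
    · intro i hi hi'
      simp [seg, blockLength] at hi hi'
      simp [seg, tauLetter, letterParam, List.getElem_append, List.getElem_cons]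
      grind

theorem deltaGen_eq {t j : ℕ} (ht : 4 ≤ t) (h1 : 1 ≤ j) (h2 : j ≤ t + 1) :
    deltaGen t j = (List.range (blockLength t j)).map (deltaLetter t (letterParam t j)) := by
  unfold deltaGen
  split_ifs with c1 c2 c3 c4 c5
  all_goals
    try omega
  all_goals
    apply List.ext_getElem
    · simp [ones, blockLength]; grind
    · intro i hi hi'
      simp [ones, blockLength] at hi hi'
      simp [ones, deltaLetter, letterParam, List.getElem_append, List.getElem_cons]
      grind

/-- The tables for t = 2 and t = 3 obey the same positionwise formula as the general case, so no
later argument splits on t. -/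
theorem tau_eq {t j : ℕ} (ht : 2 ≤ t) (h1 : 1 ≤ j) (h2 : j ≤ t + 1) :
    tau t j = (List.range (blockLength t j)).map (tauLetter t (letterParam t j)) := by
  match t, ht with
  | 2, _ => interval_cases j <;> decide
  | 3, _ => interval_cases j <;> decide
  | t + 4, _ => exact tauGen_eq (by omega) h1 h2

theorem delta_eq {t j : ℕ} (ht : 2 ≤ t) (h1 : 1 ≤ j) (h2 : j ≤ t + 1) :
    delta t j = (List.range (blockLength t j)).map (deltaLetter t (letterParam t j)) := by
  match t, ht with
  | 2, _ => interval_cases j <;> decide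
  | 3, _ => interval_cases j <;> decide
  | t + 4, _ => exact deltaGen_eq (by omega) h1 h2

theorem mapsLetters_tau {t : ℕ} (ht : 2 ≤ t) : MapsLetters (alphabet t) (tau t) := by
  rintro j ⟨h1, h2⟩ b hb
  rw [tau_eq ht h1 h2] at hb
  obtain ⟨i, -, rfl⟩ := List.mem_map.1 hb
  simp only [alphabet, Set.mem_Icc, tauLetter, letterParam]
  grind

theorem mapsLetters_delta {t : ℕ} (ht : 2 ≤ t) : MapsLetters (alphabet t) (delta t) := by
  rintro j ⟨h1, h2⟩ b hb
  rw [delta_eq ht h1 h2] at hb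
  obtain ⟨i, -, rfl⟩ := List.mem_map.1 hb
  simp only [alphabet, Set.mem_Icc, deltaLetter]
  grind

theorem tau_eq_cons {t j : ℕ} (ht : 2 ≤ t) (hj : j ∈ alphabet t) :
    ∃ c u, tau t j = 1 :: c :: u := by
  obtain ⟨h1, h2⟩ := hj
  obtain ⟨l, hl⟩ : ∃ l, blockLength t j = l + 2 :=
    ⟨blockLength t j - 2, by unfold blockLength; split_ifs <;> omega⟩
  rw [tau_eq ht h1 h2, hl, List.range_succ_eq_map, List.range_succ_eq_map]
  simp only [List.map_cons]
  refine ⟨_, _, congrArg (· :: _) ?_⟩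
  simp only [tauLetter, letterParam]
  grind

/-! ### The rotation by θ -/

/-- The rotation angle `θ = α - 1`, in terms of its properties. -/
structure IsAngle (t : ℕ) (θ : ℝ) : Prop where
  two_le : 2 ≤ t
  pos : 0 < θ
  mul_self : θ * (θ + t) = 1
  irrational : Irrational θ

theorem isAngle_metallicMean {t : ℕ} (ht : 2 ≤ t) : IsAngle t (metallicMean t - 1) := by
  have hs : Real.sqrt ((t : ℝ) ^ 2 + 4) ^ 2 = (t : ℝ) ^ 2 + 4 := Real.sq_sqrt (by positivity)
  have hθ : metallicMean t - 1 = (Real.sqrt ((t : ℝ) ^ 2 + 4) - t) / 2 := by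
    unfold metallicMean; ring
  refine ⟨ht, ?_, ?_, ?_⟩
  · have : (t : ℝ) < Real.sqrt ((t : ℝ) ^ 2 + 4) := Real.lt_sqrt_of_sq_lt (by linarith)
    rw [hθ]; linarith
  · rw [hθ]; linarith [hs]
  · have hi : Irrational (Real.sqrt ((t ^ 2 + 4 : ℕ) : ℝ)) := by
      rw [irrational_sqrt_natCast_iff]
      rintro ⟨r, hr⟩
      -- A square root of t² + 4 would lie strictly between t and t+2, and t+1 fails by parity.
      have h1 : t < r := by nlinarith
      have h2 : r < t + 2 := by nlinarith
      obtain rfl : r = t + 1 := by omega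
      have : 2 * t + 1 = 4 := by linarith
      omega
    push_cast at hi
    rw [hθ]
    exact_mod_cast (hi.sub_natCast t).div_natCast (m := 2) (by norm_num)

variable {t : ℕ} {θ : ℝ}

theorem IsAngle.lt_half (h : IsAngle t θ) : 2 * θ < 1 := by
  have := h.pos
  have := h.mul_self
  have : (2 : ℝ) ≤ t := by exact_mod_cast h.two_le
  by_contra hc
  nlinarith

/-- The orbit of the rotation by `θ`, starting with `θ` at `n = 0`. -/
noncomputable def orbit (θ : ℝ) (n : ℕ) : ℝ := Int.fract (((n : ℝ) + 1) * θ)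

/-- The parameter of the `n`-th letter of the fixed point of `τ`. -/
noncomputable def param (t : ℕ) (θ : ℝ) (n : ℕ) : ℕ := ⌊orbit θ n * (t - 1 + θ)⌋₊ + 1

/-- The `n`-th letter of the fixed point of `τ` has an image of length `t + 1`. -/
def IsLong (θ : ℝ) (n : ℕ) : Prop := 1 - θ ≤ orbit θ n

/-- The position at which the image of the `n`-th letter begins. -/
noncomputable def blockStart (t : ℕ) (θ : ℝ) (n : ℕ) : ℕ := n * t + ⌊((n : ℝ) + 1) * θ⌋₊

theorem IsAngle.lin_indep (h : IsAngle t θ) {a b : ℤ} (hab : (a : ℝ) = b * θ) : b = 0 := by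
  by_contra hb
  exact (h.irrational.intCast_mul hb).ne_int a hab.symm

theorem floor_add_orbit (h : IsAngle t θ) (n : ℕ) :
    ((n : ℝ) + 1) * θ = ⌊((n : ℝ) + 1) * θ⌋₊ + orbit θ n := by
  have := h.pos
  rw [orbit, Int.fract, natCast_floor_eq_intCast_floor (by positivity)]
  ring

theorem orbit_pos (h : IsAngle t θ) (n : ℕ) : 0 < orbit θ n := by
  refine lt_of_le_of_ne (Int.fract_nonneg _) fun h0 => ?_
  have h1 := floor_add_orbit h n
  have := h.lin_indep (a := ⌊((n : ℝ) + 1) * θ⌋₊) (b := n + 1) (by push_cast; linarith)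
  omega

theorem orbit_lt_one (θ : ℝ) (n : ℕ) : orbit θ n < 1 := Int.fract_lt_one _

/-- Reducing by θ² = 1 - tθ turns an equality into an integer relation between 1 and θ with
θ-coefficient n+1+k > 0. The resulting strictness in `param_lt` is needed where the floor of a
negated quantity is taken. -/
theorem orbit_mul_ne (h : IsAngle t θ) (n : ℕ) (q : ℤ) : orbit θ n * (t - 1 + θ) ≠ q := fun h0 => by
  have h1 := floor_add_orbit h n
  have hm := h.mul_self
  set k := ⌊((n : ℝ) + 1) * θ⌋₊
  have := h.lin_indep (a := n + 1 - k * (t - 1) - q) (b := n + 1 + k) (by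
    push_cast
    have : orbit θ n = (n + 1) * θ - k := by linarith
    rw [this] at h0
    linear_combination h0 - (n + 1) * hm)
  omega

theorem coef_pos (h : IsAngle t θ) : 0 < t - 1 + θ := by
  have := h.pos
  have : (2 : ℝ) ≤ t := by exact_mod_cast h.two_le
  linarith

theorem param_eq (h : IsAngle t θ) {n m : ℕ} (h1 : (m : ℝ) ≤ orbit θ n * (t - 1 + θ))
    (h2 : orbit θ n * (t - 1 + θ) < m + 1) : param t θ n = m + 1 := by
  rw [param, (Nat.floor_eq_iff (mul_nonneg (orbit_pos h n).le (coef_pos h).le)).2 ⟨h1, h2⟩]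

theorem lt_param (t : ℕ) (θ : ℝ) (n : ℕ) : orbit θ n * (t - 1 + θ) < param t θ n := by
  simpa [param] using Nat.lt_floor_add_one (orbit θ n * (t - 1 + θ))

theorem param_lt (h : IsAngle t θ) (n : ℕ) : (param t θ n : ℝ) < orbit θ n * (t - 1 + θ) + 1 := by
  have h1 := Nat.floor_le (mul_nonneg (orbit_pos h n).le (coef_pos h).le)
  have h2 := orbit_mul_ne h n ⌊orbit θ n * (t - 1 + θ)⌋₊
  simp only [param, Nat.cast_add, Nat.cast_one]
  have := lt_of_le_of_ne h1 (by simpa using h2.symm)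
  linarith

theorem one_le_param (t : ℕ) (θ : ℝ) (n : ℕ) : 1 ≤ param t θ n := by simp [param]

theorem param_le (h : IsAngle t θ) (n : ℕ) : param t θ n ≤ t := by
  have h1 := param_lt h n
  have h2 := orbit_lt_one θ n
  have h3 := mul_lt_mul_of_pos_right h2 (coef_pos h)
  have h4 := h.lt_half
  have : (param t θ n : ℝ) < (t + 1 : ℕ) := by push_cast; linarith [h.pos]
  exact Nat.lt_succ_iff.1 (by exact_mod_cast this)

/-- The wrap threshold 1-θ scales to t-2+2θ, strictly between t-2 and t-1, so it cuts only the
interval where `param` is t-1; this is why one extra letter t+1 suffices. -/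
theorem param_lt_of_not_isLong (h : IsAngle t θ) {n : ℕ} (hn : ¬ IsLong θ n) :
    param t θ n < t := by
  have h1 := param_lt h n
  have h2 := mul_lt_mul_of_pos_right (not_le.1 hn) (coef_pos h)
  have h3 : (1 - θ) * (t - 1 + θ) = t - 2 + 2 * θ := by linear_combination -h.mul_self
  have h4 := h.lt_half
  have : (param t θ n : ℝ) < t := by linarith
  exact_mod_cast this

theorem le_param_of_isLong (h : IsAngle t θ) {n : ℕ} (hn : IsLong θ n) :
    t ≤ param t θ n + 1 := by
  have h1 := lt_param t θ n
  have h2 := mul_le_mul_of_nonneg_right hn (coef_pos h).le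
  have h3 : (1 - θ) * (t - 1 + θ) = t - 2 + 2 * θ := by linear_combination -h.mul_self
  have : (t : ℝ) < (param t θ n + 2 : ℕ) := by push_cast; linarith [h.pos]
  have : t < param t θ n + 2 := by exact_mod_cast this
  omega

theorem orbit_eq {n : ℕ} {z : ℝ} (h0 : 0 ≤ z) (h1 : z < 1) (q : ℤ) (hq : (n + 1) * θ - z = q) :
    orbit θ n = z :=
  Int.fract_eq_iff.2 ⟨h0, h1, q, hq⟩

theorem orbit_succ_of_isLong (h : IsAngle t θ) {n : ℕ} (hn : IsLong θ n) :
    orbit θ (n + 1) = orbit θ n + θ - 1 := by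
  have := orbit_lt_one θ n
  have hn' : 1 - θ ≤ orbit θ n := hn
  refine orbit_eq (by linarith) (by linarith [h.lt_half, h.pos])
    (⌊((n : ℝ) + 1) * θ⌋₊ + 1) ?_
  push_cast
  linarith [floor_add_orbit h n]

theorem orbit_succ_of_not_isLong (h : IsAngle t θ) {n : ℕ} (hn : ¬ IsLong θ n) :
    orbit θ (n + 1) = orbit θ n + θ := by
  have hn' : orbit θ n < 1 - θ := not_le.1 hn
  refine orbit_eq (by linarith [orbit_pos h n, h.pos]) (by linarith)
    ⌊((n : ℝ) + 1) * θ⌋₊ ?_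
  push_cast
  linarith [floor_add_orbit h n]

open Classical in
theorem floor_succ (h : IsAngle t θ) (n : ℕ) :
    ⌊(((n + 1 : ℕ) : ℝ) + 1) * θ⌋₊ = ⌊((n : ℝ) + 1) * θ⌋₊ + if IsLong θ n then 1 else 0 := by
  have h1 := floor_add_orbit h n
  have h2 := floor_add_orbit h (n + 1)
  split_ifs with hn
  · have h3 := orbit_succ_of_isLong h hn
    have : ((⌊(((n + 1 : ℕ) : ℝ) + 1) * θ⌋₊ : ℕ) : ℝ) = (⌊((n : ℝ) + 1) * θ⌋₊ + 1 : ℕ) := by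
      push_cast at h2 ⊢; linarith
    exact_mod_cast this
  · have h3 := orbit_succ_of_not_isLong h hn
    have : ((⌊(((n + 1 : ℕ) : ℝ) + 1) * θ⌋₊ : ℕ) : ℝ) = (⌊((n : ℝ) + 1) * θ⌋₊ + 0 : ℕ) := by
      push_cast at h2 ⊢; linarith
    exact_mod_cast this

theorem blockStart_zero (h : IsAngle t θ) : blockStart t θ 0 = 0 := by
  have := h.lt_half
  have := h.pos
  simp [blockStart]; linarith

open Classical in
theorem blockStart_succ (h : IsAngle t θ) (n : ℕ) :
    blockStart t θ (n + 1) = blockStart t θ n + if IsLong θ n then t + 1 else t := by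
  rw [blockStart, blockStart, floor_succ h]
  split_ifs <;> ring

/-! ### Self-similarity: the orbit along a block -/

/-- Replacing ⌊(n+1)θ⌋ by (n+1)θ minus the orbit point leaves the main term (n+1)(t+θ)θ = n+1,
corrected by a multiple of θ. -/
theorem orbit_blockStart_add (h : IsAngle t θ) (n : ℕ) {i : ℕ} (hi : i < t) :
    orbit θ (blockStart t θ n + i) = 1 - (t - 1 - i + orbit θ n) * θ := by
  have hi' : (i : ℝ) + 1 ≤ t := by exact_mod_cast hi
  have h0 := orbit_pos h n
  have h1 := orbit_lt_one θ n
  have hm := h.mul_self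
  have hp := h.pos
  refine orbit_eq ?_ ?_ n ?_
  · nlinarith [mul_nonneg hp.le (Nat.cast_nonneg (α := ℝ) i), mul_nonneg hp.le hp.le]
  · have : 0 < (t - 1 - i + orbit θ n) * θ := mul_pos (by linarith) hp
    linarith
  · have hf := floor_add_orbit h n
    simp only [blockStart]
    push_cast
    linear_combination (n + 1) * hm - θ * hf

/-- Valid for both block lengths: after a block of length t, this position is the first one of the
next block. -/
theorem orbit_blockStart_add_of_isLong (h : IsAngle t θ) (n : ℕ) :
    orbit θ (blockStart t θ n + t) = (1 - orbit θ n) * θ := by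
  have h0 := orbit_pos h n
  have h1 := orbit_lt_one θ n
  have hm := h.mul_self
  have hp := h.pos
  have hh := h.lt_half
  refine orbit_eq ?_ ?_ (n + 1) ?_
  · exact mul_nonneg (by linarith) hp.le
  · nlinarith
  · have hf := floor_add_orbit h n
    simp only [blockStart]
    push_cast
    linear_combination (n + 1) * hm - θ * hf

theorem isLong_blockStart_add_iff (h : IsAngle t θ) (n : ℕ) {i : ℕ} (hi : i < t) :
    IsLong θ (blockStart t θ n + i) ↔ i + 1 = t := by
  rw [IsLong, orbit_blockStart_add h n hi]
  have h0 := orbit_pos h n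
  have h1 := orbit_lt_one θ n
  have hp := h.pos
  constructor
  · intro hl
    by_contra hne
    have : (i : ℝ) + 2 ≤ t := by exact_mod_cast (by omega : i + 2 ≤ t)
    nlinarith
  · rintro rfl
    push_cast
    nlinarith

theorem not_isLong_blockStart_add (h : IsAngle t θ) (n : ℕ) :
    ¬ IsLong θ (blockStart t θ n + t) := by
  rw [IsLong, orbit_blockStart_add_of_isLong h n]
  have h0 := orbit_pos h n
  have hp := h.pos
  have hh := h.lt_half
  nlinarith

/-- With u the scaled orbit point of n, the scaled point at index i is i + θ(t - i - u). Its floor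
is i or i-1 according to the sign of t - i - u, which `param` of n decides. -/
theorem param_blockStart_add (h : IsAngle t θ) (n : ℕ) {i : ℕ} (hi : i < t) :
    param t θ (blockStart t θ n + i) = if i + param t θ n ≤ t then i + 1 else i := by
  have hi' : (i : ℝ) + 1 ≤ t := by exact_mod_cast hi
  have hp := h.pos
  have hm := h.mul_self
  have h1 := lt_param t θ n
  have h2 := param_lt h n
  have h0 := orbit_pos h n
  have h3 := mul_lt_mul_of_pos_right (orbit_lt_one θ n) (coef_pos h)
  have h4 := mul_pos h0 (coef_pos h)
  have hu : orbit θ (blockStart t θ n + i) * (t - 1 + θ) =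
      i + θ * (t - i - orbit θ n * (t - 1 + θ)) := by
    rw [orbit_blockStart_add h n hi]
    linear_combination (-t + 1 + i) * hm
  set u := orbit θ n * (t - 1 + θ)
  split_ifs with hc
  · have hc' : (i : ℝ) + param t θ n ≤ t := by exact_mod_cast hc
    apply param_eq h <;> rw [hu]
    · nlinarith
    · have : θ * (t - i - u) < 1 := by nlinarith [Nat.cast_nonneg (α := ℝ) i]
      linarith
  · have hc' : (t : ℝ) + 1 ≤ i + param t θ n := by exact_mod_cast (by omega : t + 1 ≤ _)
    have hle := param_le h n
    -- Index 0 is excluded here because `param` is at most t.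
    obtain ⟨k, rfl⟩ : ∃ k, i = k + 1 := ⟨i - 1, by omega⟩
    apply param_eq h <;> rw [hu]
    · push_cast at *
      nlinarith
    · push_cast at *
      nlinarith

theorem param_blockStart_add_self (h : IsAngle t θ) (n : ℕ) :
    param t θ (blockStart t θ n + t) = 1 := by
  have h0 := orbit_pos h n
  have h1 := orbit_lt_one θ n
  have hp := h.pos
  have hh := h.lt_half
  have hu : orbit θ (blockStart t θ n + t) * (t - 1 + θ) = (1 - orbit θ n) * (1 - θ) := by
    rw [orbit_blockStart_add_of_isLong h n]
    linear_combination (1 - orbit θ n) * h.mul_self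
  refine param_eq h (m := 0) ?_ ?_ <;> rw [hu]
  · push_cast; exact mul_nonneg (by linarith) (by linarith)
  · push_cast; nlinarith

/-! ### The iterated Beatty sequence in terms of the rotation -/

theorem beatty_one_add (θ : ℝ) (n : ℤ) : beatty (θ + 1) n = n + ⌊(n : ℝ) * θ⌋ := by
  rw [beatty, show (n : ℝ) * (θ + 1) = n * θ + n by ring, Int.floor_add_intCast, add_comm]

theorem beatty_beatty (h : IsAngle t θ) (n : ℕ) :
    beatty (θ + 1) (beatty (θ + 1) (n + 1)) =
      2 * (n + 1) + (2 - t) * ⌊((n : ℝ) + 1) * θ⌋₊ - param t θ n := by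
  have hp := h.pos
  have hf := floor_add_orbit h n
  have hfl : ⌊(((n : ℤ) + 1 : ℤ) : ℝ) * θ⌋ = (⌊((n : ℝ) + 1) * θ⌋₊ : ℤ) := by
    push_cast
    exact (Int.natCast_floor_eq_floor (by positivity)).symm
  rw [beatty_one_add _ (n + 1), hfl, beatty_one_add]
  set k := ⌊((n : ℝ) + 1) * θ⌋₊
  suffices hs : ⌊(((n + 1 + k : ℤ)) : ℝ) * θ⌋ = n + 1 + (1 - t) * k - param t θ n by
    rw [hs]; ring
  rw [Int.floor_eq_iff]
  have h1 := lt_param t θ n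
  have h2 := param_lt h n
  have hy : orbit θ n = (n + 1) * θ - k := by linarith
  have key : (n + 1 + k : ℝ) * θ = n + 1 + (1 - t) * k - orbit θ n * (t - 1 + θ) := by
    rw [hy]; linear_combination ((n : ℝ) + 1) * h.mul_self
  push_cast
  rw [key]
  constructor <;> linarith

open Classical in
theorem deltaAA_eq (h : IsAngle t θ) (n : ℕ) :
    deltaAA (θ + 1) n =
      2 + (if IsLong θ n then 2 - (t : ℤ) else 0) + param t θ n - param t θ (n + 1) := by
  have h1 := beatty_beatty h n
  have h2 := beatty_beatty h (n + 1)
  rw [floor_succ h] at h2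
  push_cast at h1 h2
  simp only [deltaAA, firstDiff]
  rw [h1, h2]
  split_ifs <;> push_cast <;> ring

/-! ### The fixed point and its decoration -/

open Classical in
/-- The fixed point of `τ`. -/
noncomputable def fixedWord (t : ℕ) (θ : ℝ) (n : ℕ) : ℕ :=
  if IsLong θ n then (if param t θ n = t then t else t + 1) else param t θ n

theorem fixedWord_mem (h : IsAngle t θ) (n : ℕ) :
    1 ≤ fixedWord t θ n ∧ fixedWord t θ n ≤ t + 1 := by
  have := h.two_le
  have := one_le_param t θ n
  have := param_le h n
  unfold fixedWord
  split_ifs <;> omega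

theorem letterParam_fixedWord (h : IsAngle t θ) (n : ℕ) :
    letterParam t (fixedWord t θ n) = param t θ n := by
  have := h.two_le
  have := param_le h n
  have := le_param_of_isLong h (n := n)
  unfold fixedWord letterParam
  grind

open Classical in
theorem blockLength_fixedWord (h : IsAngle t θ) (n : ℕ) :
    blockLength t (fixedWord t θ n) = if IsLong θ n then t + 1 else t := by
  have := param_lt_of_not_isLong h (n := n)
  unfold fixedWord blockLength
  grind

theorem isLong_of_le_of_lt_blockLength (h : IsAngle t θ) {n i : ℕ} (h1 : t ≤ i)
    (h2 : i < blockLength t (fixedWord t θ n)) : IsLong θ n ∧ i = t := by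
  rw [blockLength_fixedWord h] at h2
  grind

theorem fixedWord_blockStart_add (h : IsAngle t θ) {n i : ℕ}
    (hi : i < blockLength t (fixedWord t θ n)) :
    fixedWord t θ (blockStart t θ n + i) = tauLetter t (param t θ n) i := by
  have ht := h.two_le
  have := one_le_param t θ n
  rcases lt_or_ge i t with hit | hit
  · simp only [fixedWord, isLong_blockStart_add_iff h n hit, param_blockStart_add h n hit,
      tauLetter]
    grind
  · obtain ⟨-, rfl⟩ := isLong_of_le_of_lt_blockLength h hit hi
    simp [fixedWord, not_isLong_blockStart_add h n, param_blockStart_add_self h n, tauLetter]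

theorem param_blockStart_add_of_eq (h : IsAngle t θ) {n i : ℕ}
    (hi : i = blockLength t (fixedWord t θ n)) : param t θ (blockStart t θ n + i) = 1 := by
  have h1 := param_blockStart_add h (n + 1) (i := 0) (by have := h.two_le; omega)
  have h2 := param_le h (n + 1)
  rw [blockStart_succ h, ← blockLength_fixedWord h, ← hi] at h1
  simpa [h2] using h1

/-- Before the wrap `param` rises by 1 at each step (letter 1), except for one stall at i + `param`
= t (letter 2). At the wrap it drops to 1, and the extra 2 - t leaves 3 or 2. The additional letter
of a long block is 2, as `param` is 1 there and at the next block start. -/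
theorem deltaAA_blockStart_add (h : IsAngle t θ) {n i : ℕ}
    (hi : i < blockLength t (fixedWord t θ n)) :
    deltaAA (θ + 1) (blockStart t θ n + i) = deltaLetter t (param t θ n) i := by
  have ht := h.two_le
  have h1 := one_le_param t θ n
  have h2 := param_le h n
  have h3 := param_blockStart_add_self h n
  rw [deltaAA_eq h, add_assoc (blockStart t θ n)]
  rcases lt_or_ge i t with hit | hit
  · rw [param_blockStart_add h n hit]
    simp only [isLong_blockStart_add_iff h n hit, deltaLetter]
    rcases Nat.lt_or_ge (i + 1) t with hi1 | hi1
    · rw [param_blockStart_add h n hi1]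
      grind
    · obtain rfl : i + 1 = t := by omega
      rw [h3]
      grind
  · obtain ⟨hl, rfl⟩ := isLong_of_le_of_lt_blockLength h hit hi
    rw [param_blockStart_add_of_eq h (i := i + 1) (by rw [blockLength_fixedWord h, if_pos hl]), h3]
    simp [not_isLong_blockStart_add h n, deltaLetter]

theorem blockStart_succ_eq_add_blockLength (h : IsAngle t θ) (n : ℕ) :
    blockStart t θ (n + 1) = blockStart t θ n + blockLength t (fixedWord t θ n) := by
  rw [blockStart_succ h, blockLength_fixedWord h]

theorem two_le_blockLength {t : ℕ} (ht : 2 ≤ t) (j : ℕ) : 2 ≤ blockLength t j := by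
  unfold blockLength
  split_ifs <;> omega

theorem tau_fixedWord (h : IsAngle t θ) (n : ℕ) :
    tau t (fixedWord t θ n) =
      wordPrefix (fun i => fixedWord t θ (blockStart t θ n + i))
        (blockLength t (fixedWord t θ n)) := by
  rw [tau_eq h.two_le (fixedWord_mem h n).1 (fixedWord_mem h n).2, letterParam_fixedWord h]
  exact List.map_congr_left fun i hi => (fixedWord_blockStart_add h (List.mem_range.1 hi)).symm

theorem delta_fixedWord (h : IsAngle t θ) (n : ℕ) :
    (delta t (fixedWord t θ n)).map (fun i : ℕ => (i : ℤ)) =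
      wordPrefix (fun i => deltaAA (θ + 1) (blockStart t θ n + i))
        (blockLength t (fixedWord t θ n)) := by
  rw [delta_eq h.two_le (fixedWord_mem h n).1 (fixedWord_mem h n).2, letterParam_fixedWord h,
    List.map_map]
  exact List.map_congr_left fun i hi => (deltaAA_blockStart_add h (List.mem_range.1 hi)).symm

theorem isFixedPointOn_fixedWord (h : IsAngle t θ) :
    IsFixedPointOn (alphabet t) (tau t) (fixedWord t θ) :=
  ⟨fixedWord_mem h, isImage_of_blocks (blockStart_zero h) (blockStart_succ_eq_add_blockLength h)
    (fun _ => one_le_two.trans (two_le_blockLength h.two_le _)) (tau_fixedWord h)⟩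

theorem isImage_delta_fixedWord (h : IsAngle t θ) :
    IsImage (fun j : ℕ => (delta t j).map (fun i : ℕ => (i : ℤ))) (fixedWord t θ)
      (deltaAA (θ + 1)) :=
  isImage_of_blocks (blockStart_zero h) (blockStart_succ_eq_add_blockLength h)
    (fun _ => one_le_two.trans (two_le_blockLength h.two_le _)) (delta_fixedWord h)

/-- Crude bounds: only finiteness of the alphabet of pairs is needed. -/
theorem deltaAA_mem (h : IsAngle t θ) (n : ℕ) :
    deltaAA (θ + 1) n ∈ Set.Icc (-2 * t : ℤ) (2 * t + 2) := by
  have := one_le_param t θ n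
  have := param_le h n
  have := one_le_param t θ (n + 1)
  have := param_le h (n + 1)
  rw [deltaAA_eq h, Set.mem_Icc]
  split_ifs <;> constructor <;> omega

/-- The pairs of a letter of the fixed point of `τ` and the letter of `ΔAA` at the same position
form a fixed point of the morphism `(j, d) ↦ τ(j) × δ(j)`, since `τ(j)` and `δ(j)` have the same
length. -/
theorem isMorphic_deltaAA (h : IsAngle t θ) : IsMorphic (deltaAA (θ + 1)) := by
  refine isMorphic_of_blocks (P := blockStart t θ)
    (Y := fun n => (fixedWord t θ n, deltaAA (θ + 1) n))
    (φ := fun p => (tau t p.1).zip ((delta t p.1).map (fun i : ℕ => (i : ℤ))))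
    (L := fun n => blockLength t (fixedWord t θ n)) ?_ (blockStart_zero h)
    (blockStart_succ_eq_add_blockLength h)
    (fun _ => one_le_two.trans (two_le_blockLength h.two_le _))
    (two_le_blockLength h.two_le _) (fun n => ?_) Prod.snd
  · refine ((Set.finite_Icc 1 (t + 1)).prod
      (Set.finite_Icc (-2 * t : ℤ) (2 * t + 2))).subset ?_
    rintro _ ⟨n, rfl⟩
    exact ⟨fixedWord_mem h n, deltaAA_mem h n⟩
  · simp only [tau_fixedWord h, delta_fixedWord h, wordPrefix, List.zip_map']

end MetallicBeatty

theorem mainTheorem1 (t : ℕ) (ht : 2 ≤ t) :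
    MetallicBeatty.IsMorphic (MetallicBeatty.deltaAA (MetallicBeatty.metallicMean t)) ∧
    MetallicBeatty.MapsLetters (MetallicBeatty.alphabet t) (MetallicBeatty.tau t) ∧
    MetallicBeatty.MapsLetters (MetallicBeatty.alphabet t) (MetallicBeatty.delta t) ∧
    ∃ x : ℕ → ℕ,
      (MetallicBeatty.IsFixedPointOn (MetallicBeatty.alphabet t) (MetallicBeatty.tau t) x ∧
        ∀ y : ℕ → ℕ,
          MetallicBeatty.IsFixedPointOn (MetallicBeatty.alphabet t) (MetallicBeatty.tau t) y →
            y = x) ∧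
      MetallicBeatty.IsImage
        (fun j : ℕ => (MetallicBeatty.delta t j).map (fun i : ℕ => (i : ℤ))) x
        (MetallicBeatty.deltaAA (MetallicBeatty.metallicMean t)) := by
  obtain ⟨θ, hθ, h⟩ : ∃ θ, MetallicBeatty.metallicMean t = θ + 1 ∧ MetallicBeatty.IsAngle t θ :=
    ⟨_, (sub_add_cancel _ _).symm, MetallicBeatty.isAngle_metallicMean ht⟩
  rw [hθ]
  exact ⟨MetallicBeatty.isMorphic_deltaAA h, MetallicBeatty.mapsLetters_tau ht,
    MetallicBeatty.mapsLetters_delta ht, MetallicBeatty.fixedWord t θ,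
    ⟨MetallicBeatty.isFixedPointOn_fixedWord h, fun y hy =>
      MetallicBeatty.isFixedPointOn_unique 1 (fun _ => MetallicBeatty.tau_eq_cons ht)
        (MetallicBeatty.isFixedPointOn_fixedWord h) hy⟩,
    MetallicBeatty.isImage_delta_fixedWord h⟩
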